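/- Define the $(q,t)$-Catalan numbers $C_n(t,q)$ as the Taylor coefficients of the formal continued fraction $$\sum_{n\ge 0} C_n(t,q)z^n=\cfrac{1}{1-\cfrac{z}{1-\cfrac{tz}{1-\cfrac{qz}{1-\cfrac{tqz}{1-\cfrac{q^2z}{1-\cfrac{tq^2z}{\ddots}}}}}}},$$ whose successive coefficients are $1,t,q,tq,\dots,q^{k-1},tq^{k-1},\dots$, and define Carlitz's $q$-Catalan numbers by $C_n(q):=C_n(q,q^2)$. Let $\mathfrak S_n(321)$ be the set of permutations $\pi$ of $\{1,\dots,n\}$ avoiding the pattern $321$, and $\mathfrak D_n(321)$ the subset of those without fixed points. Let $\mathsf{exc}\,\pi=\#\{i:\pi(i)>i\}$ and $\mathsf{inv}\,\pi=\#\{(i,j): i<j,\ \pi(i)>\pi(j)\}$. Then, for every $n\ge 1$, $$C_n(-1,q)=\sum_{\pi\in\mathfrak S_n(321)}(-1)^{\mathsf{exc}\,\pi}q^{\mathsf{inv}\,\pi-\mathsf{exc}\,\pi}=\begin{cases}0&\text{if } n \text{ is even},\\ (-q)^{\frac{n-1}{2}}C_{\frac{n-1}{2}}(q^2)&\text{if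 } n\text{ is odd},\end{cases}$$ $$\sum_{\pi\in\mathfrak D_n(321)}(-1)^{\mathsf{exc}\,\pi}q^{\mathsf{inv}\,\pi}=\begin{cases}(-q)^{\frac n2}C_{\frac n2}(q^2)&\text{if } n\text{ is even},\\ 0&\text{if } n \text{ is odd}.\end{cases}$$ These are identities of polynomials in $q$; equivalently, they hold for every element $q$ of every commutative ring. -/

import Mathlib

open Finset PowerSeries

/-- `π` avoids the pattern `p`: there are no positions `i₁ < ⋯ < i_k` such that the word
`π(i₁) ⋯ π(i_k)` is order-isomorphic to `p`. -/
def AvoidsPattern {n k : ℕ} (π : Equiv.Perm (Fin n)) (p : Equiv.Perm (Fin k)) : Prop :=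
  ¬ ∃ f : Fin k ↪o Fin n, ∀ a b : Fin k, π (f a) < π (f b) ↔ p a < p b

/-- The pattern `321`. -/
def pattern321 : Equiv.Perm (Fin 3) := Fin.revPerm

open scoped Classical in
/-- The set of permutations of length `n` that avoid `321`. -/
noncomputable def perms321 (n : ℕ) : Finset (Equiv.Perm (Fin n)) :=
  {π | AvoidsPattern π pattern321}

open scoped Classical in
/-- The set of derangements of length `n` that avoid `321`. -/
noncomputable def derangements321 (n : ℕ) : Finset (Equiv.Perm (Fin n)) :=
  {π ∈ perms321 n | π ∈ derangements (Fin n)}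

/-- The number of excedances of `π`. -/
def excNum {n : ℕ} (π : Equiv.Perm (Fin n)) : ℕ :=
  #{i : Fin n | i < π i}

/-- The number of inversions of `π`. -/
def invNum {n : ℕ} (π : Equiv.Perm (Fin n)) : ℕ :=
  #{x : Fin n × Fin n | x.1 < x.2 ∧ π x.2 < π x.1}

/-- Every permutation has at least as many inversions as excedances, so the natural-number
difference `invNum π - excNum π` is the true difference. -/
theorem excNum_le_invNum {n : ℕ} (π : Equiv.Perm (Fin n)) : excNum π ≤ invNum π := by
  have key : ∀ i : Fin n, i < π i → ∃ j, i < j ∧ π j < π i := by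
    intro i hi
    by_contra! h
    have hsub : (Finset.Iio (π i)).image π.symm ⊆ Finset.Iio i := by
      intro j hj
      obtain ⟨v, hv, rfl⟩ := Finset.mem_image.mp hj
      rw [Finset.mem_Iio] at hv ⊢
      by_contra hc
      rcases (not_lt.mp hc).lt_or_eq with h1 | h1
      · have := h _ h1
        rw [Equiv.apply_symm_apply] at this
        exact absurd hv (not_lt.mpr this)
      · rw [h1, Equiv.apply_symm_apply] at hv
        exact lt_irrefl _ hv
    have hc := Finset.card_le_card hsub
    rw [Finset.card_image_of_injective _ π.symm.injective, Fin.card_Iio, Fin.card_Iio] at hc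
    exact absurd hi (not_lt.mpr hc)
  choose! g hg using key
  refine Finset.card_le_card_of_injOn (fun i => (i, g i)) ?_ ?_
  · intro i hi
    simpa using hg i (by simpa using hi)
  · intro i _ j _ hij
    exact congrArg Prod.fst hij

/-- The finite continued fraction
`1 / (1 - c₀ z / (1 - c₁ z / (⋯ / (1 - c_{N-1} z))))` as a formal power series in `z`. -/
noncomputable def convergent {R : Type*} [CommRing R] : (ℕ → R) → ℕ → PowerSeries R
  | _, 0 => 1
  | c, N + 1 =>
    invOfUnit (1 - PowerSeries.C (c 0) * PowerSeries.X * convergent (fun i => c (i + 1)) N) 1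

/-- The infinite continued fraction `1 / (1 - c₀ z / (1 - c₁ z / (1 - c₂ z / ⋯)))`, as the
coefficientwise limit of its finite convergents (see `coeff_convergent` for the stabilization). -/
noncomputable def stieltjesFraction {R : Type*} [CommRing R] (c : ℕ → R) : PowerSeries R :=
  PowerSeries.mk fun n => PowerSeries.coeff n (convergent c n)

theorem convergent_succ_mul {R : Type*} [CommRing R] (c : ℕ → R) (N : ℕ) :
    (1 - PowerSeries.C (c 0) * PowerSeries.X * convergent (fun i => c (i + 1)) N) *
      convergent c (N + 1) = 1 := by
  rw [convergent]
  exact mul_invOfUnit _ _ (by simp)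

theorem X_pow_dvd_convergent_sub {R : Type*} [CommRing R] (n : ℕ) :
    ∀ (c : ℕ → R) (N : ℕ), n ≤ N →
      (PowerSeries.X : PowerSeries R) ^ (n + 1) ∣ convergent c N - convergent c n := by
  induction n with
  | zero =>
    intro c N _
    rw [zero_add, pow_one, X_dvd_iff]
    cases N with
    | zero => simp
    | succ N => simp [convergent]
  | succ n ih =>
    intro c N hN
    obtain ⟨M, rfl⟩ : ∃ M, N = M + 1 := ⟨N - 1, by omega⟩
    obtain ⟨d, hd⟩ := ih (fun i => c (i + 1)) M (by omega)
    have h1 := convergent_succ_mul c M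
    have h2 := convergent_succ_mul c n
    set A := convergent (fun i => c (i + 1)) M
    set B := convergent (fun i => c (i + 1)) n
    set P := convergent c (M + 1)
    set Q := convergent c (n + 1)
    refine ⟨PowerSeries.C (c 0) * d * P * Q, ?_⟩
    have h3 : P - Q = PowerSeries.C (c 0) * PowerSeries.X * (A - B) * P * Q := by
      linear_combination (-P) * h2 + Q * h1
    rw [h3, hd]
    ring

/-- The `n`-th coefficient of the convergents is constant from the `n`-th convergent on, and equals
that of the infinite continued fraction. -/
theorem coeff_convergent {R : Type*} [CommRing R] (c : ℕ → R) {n N : ℕ} (h : n ≤ N) :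
    PowerSeries.coeff n (convergent c N) = PowerSeries.coeff n (stieltjesFraction c) := by
  have := X_pow_dvd_iff.mp (X_pow_dvd_convergent_sub n c N h) n (Nat.lt_succ_self n)
  rw [map_sub, sub_eq_zero] at this
  rw [this, stieltjesFraction, coeff_mk]

/-- The partial numerators `1, t, q, tq, q², tq², …`. -/
def narayanaWeights {R : Type*} [CommRing R] (t q : R) (i : ℕ) : R :=
  if Even i then q ^ (i / 2) else t * q ^ (i / 2)

/-- The `(q,t)`-Catalan number `C_n(t,q)`: the coefficient of `z ^ n` in
`1 / (1 - z / (1 - t z / (1 - q z / (1 - t q z / (1 - q² z / (1 - t q² z / ⋯))))))`. -/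
noncomputable def qtCatalan {R : Type*} [CommRing R] (n : ℕ) (t q : R) : R :=
  PowerSeries.coeff n (stieltjesFraction (narayanaWeights t q))

/-- Carlitz's `q`-Catalan number `C_n(q) = C_n(q, q²)`. -/
noncomputable def carlitzCatalan {R : Type*} [CommRing R] (n : ℕ) (q : R) : R :=
  qtCatalan n q (q ^ 2)

/-! ### Continued fractions, products of their tails, and contraction to Motzkin paths -/

section ContinuedFraction

variable {R : Type*} [CommRing R]

/-! Two computations meet in `motzkinSum`. Combinatorially, a 321-avoiding permutation is determined
by its excedance set `E` and the set `V` of excedance values, since it increases on `E` and on the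
complement. The admissible pairs are the ballot pairs, i.e. two-coloured Motzkin paths opening at
`E` and closing at `V`. Moreover inv is the sum of `V` minus the sum of `E`, and fixed points are
the uncoloured level steps at height 0; so `sum_perms321` gives the joint distribution of exc, inv
and fixed points. Analytically, the product `P k` of the first `k` tails of a continued fraction
satisfies the linear recurrence `P (k+1) = P k + c k * z * P (k+2)`. Eliminating the even-indexed
products gives Motzkin paths with `y = 1`, hence `qtCatalan`. At `t = -1` the even-indexed products
obey the recurrence of the fraction with coefficients `-q * q ^ (2 * k)` in `z ^ 2`
(`qtCatalan_succ_neg_one`). For derangements, `t = -q` and `y = 0` kill all level steps, and the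
remaining Dyck paths give the same fraction (`motzkinSum_neg_zero`). -/

theorem X_pow_dvd_stieltjesFraction_sub (c : ℕ → R) (N : ℕ) :
    (X : PowerSeries R) ^ (N + 1) ∣ stieltjesFraction c - convergent c N := by
  rw [X_pow_dvd_iff]
  intro m hm
  rw [map_sub, coeff_convergent c (Nat.lt_succ_iff.mp hm), sub_self]

theorem eq_of_forall_X_pow_dvd_sub {f g : PowerSeries R}
    (h : ∀ n : ℕ, (X : PowerSeries R) ^ n ∣ f - g) : f = g := by
  ext n
  have := X_pow_dvd_iff.mp (h (n + 1)) n n.lt_succ_self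
  rwa [map_sub, sub_eq_zero] at this

/-- The defining functional equation of the infinite continued fraction. -/
theorem stieltjesFraction_eq (c : ℕ → R) :
    stieltjesFraction c = 1 + C (c 0) * X * stieltjesFraction c *
      stieltjesFraction (fun i => c (i + 1)) := by
  refine eq_of_forall_X_pow_dvd_sub fun n => ?_
  obtain ⟨d, hd⟩ : (X : PowerSeries R) ^ n ∣ stieltjesFraction c - convergent c (n + 1) :=
    (pow_dvd_pow _ (by omega)).trans (X_pow_dvd_stieltjesFraction_sub c (n + 1))
  obtain ⟨e, he⟩ : (X : PowerSeries R) ^ n ∣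
      stieltjesFraction (fun i => c (i + 1)) - convergent (fun i => c (i + 1)) n :=
    (pow_dvd_pow _ (by omega)).trans (X_pow_dvd_stieltjesFraction_sub _ n)
  have h := convergent_succ_mul c n
  rw [sub_eq_iff_eq_add] at hd he
  rw [hd, he]
  -- The witness is the `X ^ n`-part of the equation's defect once both fractions are written as
  -- convergent plus error; the convergents themselves cancel by `h`.
  refine ⟨d - C (c 0) * X * (d * (X ^ n * e + convergent (fun i => c (i + 1)) n) +
    convergent c (n + 1) * e), ?_⟩
  linear_combination h

/-- Every partial numerator carries one factor `z`, so a common factor `a` can be absorbed by the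
substitution `z ↦ a z`. -/
theorem stieltjesFraction_mul_left (a : R) (c : ℕ → R) :
    stieltjesFraction (fun i => a * c i) = rescale a (stieltjesFraction c) := by
  have key : ∀ (N : ℕ) (c : ℕ → R),
      convergent (fun i => a * c i) N = rescale a (convergent c N) := by
    intro N
    induction N with
    | zero => intro c; simp [convergent]
    | succ N ih =>
      intro c
      have h1 := convergent_succ_mul (fun i => a * c i) N
      have h2 := congrArg (rescale a) (convergent_succ_mul c N)
      rw [ih (fun i => c (i + 1))] at h1
      have hC : rescale a (C (c 0) : PowerSeries R) = C (c 0) := by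
        ext n
        rw [coeff_rescale, coeff_C]
        split_ifs with h <;> simp [h]
      simp only [map_mul, map_sub, map_one, rescale_X, hC] at h1 h2
      linear_combination rescale a (convergent c (N + 1)) * h1 -
        convergent (fun i => a * c i) (N + 1) * h2
  ext n
  rw [coeff_rescale, ← coeff_convergent _ le_rfl, ← coeff_convergent _ le_rfl, key, coeff_rescale]

/-- The product of the first `k` tails of a continued fraction. -/
noncomputable def tailProd (c : ℕ → R) (k : ℕ) : PowerSeries R :=
  ∏ i ∈ range k, stieltjesFraction fun j => c (i + j)

@[simp]
theorem tailProd_zero (c : ℕ → R) : tailProd c 0 = 1 := by simp [tailProd]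

theorem tailProd_one (c : ℕ → R) : tailProd c 1 = stieltjesFraction c := by simp [tailProd]

/-- This is the functional equation of the `k`-th tail multiplied by the preceding tails; it turns a
nonlinear relation into a linear recurrence. -/
theorem tailProd_succ (c : ℕ → R) (k : ℕ) :
    tailProd c (k + 1) = tailProd c k + C (c k) * X * tailProd c (k + 2) := by
  have h := stieltjesFraction_eq fun j => c (k + j)
  have h' : (fun i => c (k + (i + 1))) = fun j => c (k + 1 + j) := by
    funext i
    congr 1
    omega
  rw [h'] at h
  simp only [tailProd, prod_range_succ, add_zero] at h ⊢
  linear_combination (∏ i ∈ range k, stieltjesFraction fun j => c (i + j)) * h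

/-- A sequence of power series satisfying `U (k + 1) = U k + c k * z ^ 2 * U (k + 2)` is determined
by its first term. -/
theorem eq_of_quadratic_recurrence {c : ℕ → R} {U V : ℕ → PowerSeries R} (h0 : U 0 = V 0)
    (hU : ∀ k, U (k + 1) = U k + C (c k) * X ^ 2 * U (k + 2))
    (hV : ∀ k, V (k + 1) = V k + C (c k) * X ^ 2 * V (k + 2)) (k : ℕ) : U k = V k := by
  refine eq_of_forall_X_pow_dvd_sub fun n => ?_
  -- Outer induction on the precision in `X`, inner on the index: the term with the higher index `k
  -- + 2` carries `X ^ 2`, so lower precision suffices there.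
  induction n generalizing k with
  | zero => simp
  | succ n ih =>
    induction k with
    | zero => simp [h0]
    | succ k ihk =>
      have h : U (k + 1) - V (k + 1) = (U k - V k) + C (c k) * X ^ 2 * (U (k + 2) - V (k + 2)) := by
        rw [hU, hV]; ring
      rw [h]
      refine dvd_add ihk ?_
      obtain ⟨d, hd⟩ := ih (k + 2)
      exact ⟨C (c k) * X * d, by rw [hd]; ring⟩

/-- The weighted count of Motzkin paths with `n` steps from height `k` to height `0`. At height `k`
an up step weighs `t * q ^ k`, a down step `q ^ (k - 1)`, and the level steps together weigh `y` if
`k = 0` and `q ^ k + t * q ^ (k - 1)` otherwise. -/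
def motzkinSum (t q y : R) : ℕ → ℕ → R
  | 0, 0 => 1
  | 0, _ + 1 => 0
  | n + 1, 0 => t * motzkinSum t q y n 1 + y * motzkinSum t q y n 0
  | n + 1, k + 1 => t * q ^ (k + 1) * motzkinSum t q y n (k + 2) +
      (q ^ (k + 1) + t * q ^ k) * motzkinSum t q y n (k + 1) + q ^ k * motzkinSum t q y n k

theorem coeff_eq_motzkinSum {t q y : R} {G : ℕ → PowerSeries R}
    (h0 : G 0 = 1 + X * (C t * G 1 + C y * G 0))
    (hs : ∀ k, G (k + 1) = X * (C (t * q ^ (k + 1)) * G (k + 2) +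
      C (q ^ (k + 1) + t * q ^ k) * G (k + 1) + C (q ^ k) * G k)) (n k : ℕ) :
    coeff n (G k) = motzkinSum t q y n k := by
  induction n generalizing k with
  | zero =>
    cases k with
    | zero => rw [h0]; simp [motzkinSum]
    | succ k => rw [hs]; simp [motzkinSum]
  | succ n ih =>
    cases k with
    | zero =>
      rw [h0]
      simp [motzkinSum, coeff_succ_X_mul, coeff_one, ih]
    | succ k =>
      rw [hs, coeff_succ_X_mul, map_add, map_add, coeff_C_mul, coeff_C_mul, coeff_C_mul,
        ih, ih, ih, motzkinSum]

theorem narayanaWeights_two_mul (t q : R) (k : ℕ) : narayanaWeights t q (2 * k) = q ^ k := by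
  simp [narayanaWeights]

theorem narayanaWeights_two_mul_add_one (t q : R) (k : ℕ) :
    narayanaWeights t q (2 * k + 1) = t * q ^ k := by
  have h : (2 * k + 1) / 2 = k := by omega
  simp [narayanaWeights, h]

theorem qtCatalan_eq_motzkinSum (t q : R) (n : ℕ) :
    qtCatalan n t q = motzkinSum t q 1 n 0 := by
  set P := tailProd (narayanaWeights t q) with hP
  have heven : ∀ k, P (2 * k + 1) = P (2 * k) + C (q ^ k) * X * P (2 * k + 2) := fun k => by
    rw [← narayanaWeights_two_mul t q k, hP, ← tailProd_succ]
  have hodd : ∀ k, P (2 * k + 2) = P (2 * k + 1) + C (t * q ^ k) * X * P (2 * k + 3) := fun k => by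
    rw [← narayanaWeights_two_mul_add_one t q k, hP, ← tailProd_succ]
  -- Odd contraction of the fraction. The factor `q ^ k.choose 2` is the product of the down weights
  -- `q ^ (j - 1)` from height `k`, and `X ^ k` counts those steps.
  have := coeff_eq_motzkinSum (t := t) (q := q) (y := 1)
    (G := fun k => X ^ k * C (q ^ k.choose 2) * P (2 * k + 1)) ?_ ?_ n 0
  · rw [← this, qtCatalan, ← tailProd_one]
    simp [hP]
  · have h1 := heven 0
    have h2 := hodd 0
    have h3 : P 0 = 1 := tailProd_zero _
    simp only [mul_zero, zero_add, pow_zero, mul_one, map_one, one_mul, Nat.choose_zero_succ,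
      Nat.choose_eq_zero_of_lt one_lt_two, pow_one] at h1 h2 ⊢
    linear_combination h1 + h3 + X * h2
  · intro k
    have h1 := heven (k + 1)
    have h2 := hodd k
    have h3 := hodd (k + 1)
    have e1 : (k + 1).choose 2 = k.choose 2 + k := by
      rw [Nat.choose_succ_succ' k 1, Nat.choose_one_right, add_comm]
    have e2 : (k + 2).choose 2 = k.choose 2 + k + (k + 1) := by
      rw [Nat.choose_succ_succ' (k + 1) 1, Nat.choose_one_right, add_comm, e1]
    simp only [mul_add, mul_one, e1, e2, map_add, map_mul, map_pow] at h1 h2 h3 ⊢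
    norm_num [add_assoc] at h1 h2 h3 ⊢
    linear_combination X ^ (k + 1) * C q ^ k.choose 2 * C q ^ k * (h1 + h2 + C q ^ (k + 1) * X * h3)

/-- The even power series whose coefficients are the right-hand sides `(-q) ^ m C_m(q ^ 2)`. -/
noncomputable def signedCarlitzSeries (q : R) : PowerSeries R :=
  expand 2 two_ne_zero (stieltjesFraction fun i => -q * (q ^ 2) ^ i)

theorem narayanaWeights_sq (q : R) : narayanaWeights q (q ^ 2) = fun i => q ^ i := by
  funext i
  obtain ⟨k, rfl | rfl⟩ := i.even_or_odd'
  · rw [narayanaWeights_two_mul, pow_mul]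
  · rw [narayanaWeights_two_mul_add_one, pow_succ q (2 * k), pow_mul, mul_comm]

theorem coeff_signedCarlitzSeries (q : R) (n : ℕ) :
    coeff n (signedCarlitzSeries q) =
      if Even n then (-q) ^ (n / 2) * carlitzCatalan (n / 2) (q ^ 2) else 0 := by
  rw [signedCarlitzSeries, coeff_expand, stieltjesFraction_mul_left, coeff_rescale, carlitzCatalan,
    qtCatalan, narayanaWeights_sq]
  simp only [even_iff_two_dvd]

theorem expand_tailProd_succ (c : ℕ → R) (k : ℕ) :
    expand 2 two_ne_zero (tailProd c (k + 1)) = expand 2 two_ne_zero (tailProd c k) +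
      C (c k) * X ^ 2 * expand 2 two_ne_zero (tailProd c (k + 2)) := by
  rw [tailProd_succ, map_add, map_mul, map_mul, expand_C, expand_X]

theorem motzkinSum_neg_zero (q : R) (n : ℕ) :
    motzkinSum (-q) q 0 n 0 = coeff n (signedCarlitzSeries q) := by
  have hQ := expand_tailProd_succ fun i : ℕ => -q * (q ^ 2) ^ i
  set Q := fun k => expand 2 two_ne_zero (tailProd (fun i : ℕ => -q * (q ^ 2) ^ i) k) with hQdef
  have hQ' : ∀ k, Q (k + 1) = Q k + C (-q * (q ^ 2) ^ k) * X ^ 2 * Q (k + 2) := hQ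
  -- Here `q ^ (k + 1) + t * q ^ k = 0`, so no level steps survive, and an up step from height `k`
  -- paired with its down step weighs `-q * (q ^ 2) ^ k`.
  have := coeff_eq_motzkinSum (t := -q) (q := q) (y := 0)
    (G := fun k => X ^ k * C (q ^ k.choose 2) * Q (k + 1)) ?_ ?_ n 0
  · rw [← this, signedCarlitzSeries, ← tailProd_one]
    simp [hQdef]
  · have h1 := hQ' 0
    have h3 : Q 0 = 1 := by simp [hQdef]
    simp only [zero_add, pow_zero, mul_one, map_one, one_mul, Nat.choose_zero_succ,
      Nat.choose_eq_zero_of_lt one_lt_two, pow_one, map_zero, zero_mul, add_zero] at h1 ⊢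
    linear_combination h1 + h3
  · intro k
    have h1 := hQ' (k + 1)
    have e1 : (k + 1).choose 2 = k.choose 2 + k := by
      rw [Nat.choose_succ_succ' k 1, Nat.choose_one_right, add_comm]
    have e2 : (k + 2).choose 2 = k.choose 2 + k + (k + 1) := by
      rw [Nat.choose_succ_succ' (k + 1) 1, Nat.choose_one_right, add_comm, e1]
    simp only [e1, e2, map_add, map_mul, map_pow, map_neg] at h1 ⊢
    norm_num [add_assoc] at h1 ⊢
    linear_combination X ^ (k + 1) * C q ^ k.choose 2 * C q ^ k * h1

theorem qtCatalan_succ_neg_one (q : R) (n : ℕ) :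
    qtCatalan (n + 1) (-1) q = coeff n (signedCarlitzSeries q) := by
  set P := tailProd (narayanaWeights (-1) q) with hP
  have heven : ∀ k, P (2 * k + 1) = P (2 * k) + C (q ^ k) * X * P (2 * k + 2) := fun k => by
    rw [← narayanaWeights_two_mul (-1) q k, hP, ← tailProd_succ]
  have hodd : ∀ k, P (2 * k + 2) = P (2 * k + 1) + C (-1 * q ^ k) * X * P (2 * k + 3) := fun k => by
    rw [← narayanaWeights_two_mul_add_one (-1) q k, hP, ← tailProd_succ]
  -- At `t = -1` the two terms `q ^ k * X * P (2 * k + 2)` cancel, leaving a recurrence among even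
  -- indices only.
  have hrec : ∀ k, P (2 * (k + 1)) =
      P (2 * k) + C (-q * (q ^ 2) ^ k) * X ^ 2 * P (2 * (k + 2)) := fun k => by
    have h1 := heven k
    have h2 := hodd k
    have h3 := heven (k + 1)
    simp only [mul_add, mul_one, map_mul, map_pow, map_neg, map_one] at h1 h2 h3 ⊢
    norm_num [add_assoc] at h1 h2 h3 ⊢
    linear_combination h1 + h2 - C q ^ k * X * h3
  have key : P 2 = signedCarlitzSeries q := by
    rw [signedCarlitzSeries, ← tailProd_one]
    have hQ := expand_tailProd_succ fun i : ℕ => -q * (q ^ 2) ^ i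
    generalize hQdef : (fun k => expand 2 two_ne_zero
      (tailProd (fun i : ℕ => -q * (q ^ 2) ^ i) k)) = Q
    have hQ' : ∀ k, Q (k + 1) = Q k + C (-q * (q ^ 2) ^ k) * X ^ 2 * Q (k + 2) := by
      intro k
      rw [← hQdef]
      exact hQ k
    have hQ0 : Q 0 = 1 := by rw [← hQdef]; simp
    have hP0 : P (2 * 0) = Q 0 := by rw [hQ0, mul_zero, hP, tailProd_zero]
    have h := eq_of_quadratic_recurrence (c := fun i : ℕ => -q * (q ^ 2) ^ i)
      (U := fun k => P (2 * k)) (V := Q) hP0 hrec hQ' 1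
    rw [← hQdef] at h
    exact h
  have h0 := heven 0
  simp only [mul_zero, zero_add, pow_zero, map_one, one_mul] at h0
  rw [qtCatalan, ← tailProd_one, ← hP, h0, key, map_add, coeff_succ_X_mul, hP, tailProd_zero,
    coeff_one, if_neg n.succ_ne_zero, zero_add]

end ContinuedFraction

/-! ### Motzkin paths encoded by pairs of sets -/

section Words

variable {R : Type*} [CommRing R]

/-- The number of elements of `A` below `i`. -/
def countBelow {α : Type*} [LT α] [DecidableLT α] (A : Finset α) (i : α) : ℕ :=
  #{a ∈ A | a < i}

theorem countBelow_succ (A : Finset ℕ) (i : ℕ) :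
    countBelow A (i + 1) = countBelow A i + if i ∈ A then 1 else 0 := by
  have h : ({a ∈ A | a < i + 1} : Finset ℕ) = {a ∈ A | a < i} ∪ {a ∈ A | a = i} := by
    ext a
    simp only [mem_filter, mem_union]
    grind
  rw [countBelow, h, card_union_of_disjoint, filter_eq', countBelow]
  · split_ifs <;> simp
  · rw [disjoint_filter]
    grind

theorem countBelow_eq_card {A : Finset ℕ} {n : ℕ} (h : A ⊆ range n) : countBelow A n = #A := by
  rw [countBelow, filter_true_of_mem fun a ha => mem_range.mp (h ha)]

theorem countBelow_insert {A : Finset ℕ} {i n : ℕ} (h : i ≤ n) :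
    countBelow (insert n A) i = countBelow A i := by
  rw [countBelow, filter_insert, if_neg h.not_gt, countBelow]

/-- Double counting: each `a ∈ A` is counted at the `n - 1 - a` indices above it. -/
theorem sum_countBelow {A : Finset ℕ} {n : ℕ} (h : A ⊆ range n) :
    ∑ i ∈ range n, countBelow A i + ∑ a ∈ A, a + #A = n * #A := by
  have key : ∀ m, ∑ i ∈ range m, countBelow A i + ∑ a ∈ A with a < m, (a + 1) =
      m * countBelow A m := by
    intro m
    induction m with
    | zero => simp
    | succ m ih =>
      have hs : ∑ a ∈ A with a < m + 1, (a + 1) =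
          ∑ a ∈ A with a < m, (a + 1) + if m ∈ A then m + 1 else 0 := by
        rw [sum_filter, sum_filter, ← sum_ite_eq' A m fun a => a + 1, ← sum_add_distrib]
        refine sum_congr rfl fun a _ => ?_
        grind
      rw [sum_range_succ, hs, countBelow_succ]
      split_ifs <;> linarith
  have := key n
  rw [filter_true_of_mem fun a ha => mem_range.mp (h ha), countBelow_eq_card h,
    sum_add_distrib, sum_const, smul_eq_mul, mul_one] at this
  linarith

/-- The weight of a step of a two-coloured Motzkin path that has so far opened `a` and closed `b`
arcs; the step opens an arc if `e` and closes one if `v`. -/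
def stepWeight (t q y : R) (a b : ℕ) (e v : Prop) [Decidable e] [Decidable v] : R :=
  (if e then t else 1) * if v then if b < a then q ^ (a - b - 1) else 0
    else if b ≤ a then if e ∨ b < a then q ^ (a - b) else y else 0

/-- The weight of the two-coloured Motzkin path of length `n` that opens arcs at the steps in `E`
and closes arcs at the steps in `V`. -/
def pathWeight (t q y : R) (n : ℕ) (E V : Finset ℕ) : R :=
  ∏ i ∈ range n, stepWeight t q y (countBelow E i) (countBelow V i) (i ∈ E) (i ∈ V)

/-- The four kinds of step at height `a - b` reproduce the recursion of `motzkinSum`; the guards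
give illegal steps weight zero. -/
theorem stepWeight_transfer (t q y : R) (m a b : ℕ) :
    stepWeight t q y a b False False * (if b ≤ a then motzkinSum t q y m (a - b) else 0) +
      stepWeight t q y a b False True *
        (if b + 1 ≤ a then motzkinSum t q y m (a - (b + 1)) else 0) +
      (stepWeight t q y a b True False *
        (if b ≤ a + 1 then motzkinSum t q y m (a + 1 - b) else 0) +
      stepWeight t q y a b True True *
        (if b + 1 ≤ a + 1 then motzkinSum t q y m (a + 1 - (b + 1)) else 0)) =
    if b ≤ a then motzkinSum t q y (m + 1) (a - b) else 0 := by
  rcases lt_or_ge a b with h | h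
  · simp [stepWeight, h.not_ge, h.not_gt]
  · obtain ⟨k, rfl⟩ := Nat.exists_eq_add_of_le h
    cases k with
    | zero => simp [stepWeight, motzkinSum]; ring
    | succ k =>
      have e1 : b + (k + 1) - b = k + 1 := by omega
      have e2 : b + (k + 1) - (b + 1) = k := by omega
      have e3 : b + (k + 1) + 1 - b = k + 2 := by omega
      have e4 : b ≤ b + (k + 1) + 1 := by omega
      have e5 : b < b + (k + 1) := by omega
      have e6 : b + 1 ≤ b + (k + 1) := by omega
      have e7 : b + (k + 1) + 1 - (b + 1) = k + 1 := by omega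
      simp [stepWeight, motzkinSum, e1, e2, e3, e4, e5, e6, e7]
      ring

theorem pathWeight_congr {t q y : R} {n : ℕ} {E E' V V' : Finset ℕ}
    (hE : ∀ i < n, countBelow E i = countBelow E' i ∧ (i ∈ E ↔ i ∈ E'))
    (hV : ∀ i < n, countBelow V i = countBelow V' i ∧ (i ∈ V ↔ i ∈ V')) :
    pathWeight t q y n E V = pathWeight t q y n E' V' := by
  refine prod_congr rfl fun i hi => ?_
  have hi' := mem_range.mp hi
  simp only [stepWeight, (hE i hi').1, (hE i hi').2, (hV i hi').1, (hV i hi').2]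

theorem sum_powerset_range_succ {M : Type*} [AddCommMonoid M] (n : ℕ) (f : Finset ℕ → M) :
    ∑ A ∈ (range (n + 1)).powerset, f A =
      ∑ A ∈ (range n).powerset, (f A + f (insert n A)) := by
  rw [range_add_one, sum_powerset_insert notMem_range_self, sum_add_distrib]

/-- The set pair describes the first `n` steps and `motzkinSum` completes the path in `m` more.
Moving one step across the cut makes the induction work, which is why `m` is general. -/
theorem sum_pathWeight_mul_motzkinSum (t q y : R) (n m : ℕ) :
    ∑ E ∈ (range n).powerset, ∑ V ∈ (range n).powerset, pathWeight t q y n E V *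
      (if #V ≤ #E then motzkinSum t q y m (#E - #V) else 0) = motzkinSum t q y (n + m) 0 := by
  induction n generalizing m with
  | zero => simp [pathWeight]
  | succ n ih =>
    rw [add_right_comm, add_assoc, ← ih (m + 1), sum_powerset_range_succ]
    refine sum_congr rfl fun E hE => ?_
    rw [sum_powerset_range_succ, sum_powerset_range_succ, ← sum_add_distrib]
    refine sum_congr rfl fun V hV => ?_
    rw [mem_powerset] at hE hV
    have hnE : n ∉ E := fun h => absurd (hE h) (by simp)
    have hnV : n ∉ V := fun h => absurd (hV h) (by simp)
    have hins : ∀ A : Finset ℕ, ∀ i < n,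
        countBelow (insert n A) i = countBelow A i ∧ (i ∈ insert n A ↔ i ∈ A) := fun A i hi =>
      ⟨countBelow_insert hi.le, by simp [hi.ne]⟩
    have hid : ∀ A : Finset ℕ, ∀ i < n,
        countBelow A i = countBelow A i ∧ (i ∈ A ↔ i ∈ A) := fun _ _ _ => ⟨rfl, Iff.rfl⟩
    have h1 : ∀ A B, pathWeight t q y (n + 1) A B = pathWeight t q y n A B *
      stepWeight t q y (countBelow A n) (countBelow B n) (n ∈ A) (n ∈ B) := fun A B => by
        rw [pathWeight, prod_range_succ, pathWeight]
    simp only [h1, pathWeight_congr (hins E) (hins V), pathWeight_congr (hid E) (hins V),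
      pathWeight_congr (hins E) (hid V), countBelow_insert le_rfl, countBelow_eq_card hE,
      countBelow_eq_card hV, card_insert_of_notMem hnE, card_insert_of_notMem hnV, mem_insert_self,
      hnE, hnV]
    rw [← stepWeight_transfer]
    ring

theorem sum_pathWeight (t q y : R) (n : ℕ) :
    ∑ E ∈ (range n).powerset, ∑ V ∈ (range n).powerset,
      (if #E = #V then pathWeight t q y n E V else 0) = motzkinSum t q y n 0 := by
  rw [← add_zero n, ← sum_pathWeight_mul_motzkinSum, add_zero]
  refine sum_congr rfl fun E _ => sum_congr rfl fun V _ => ?_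
  rcases lt_trichotomy #E #V with h | h | h
  · simp [h.ne, h.not_ge]
  · simp [h, motzkinSum]
  · obtain ⟨k, hk⟩ := Nat.exists_eq_add_of_lt h
    have : #E - #V = k + 1 := by omega
    simp [h.ne', h.le, this, motzkinSum]

theorem pathWeight_eq_zero {t q y : R} {n : ℕ} {E V : Finset ℕ} {i : ℕ} (hi : i < n) (hV : i ∈ V)
    (h : countBelow E i ≤ countBelow V i) : pathWeight t q y n E V = 0 :=
  prod_eq_zero (mem_range.mpr hi) (by simp [stepWeight, hV, h.not_gt])

theorem pathWeight_eq {t q y : R} {n : ℕ} {E V : Finset ℕ} (hE : E ⊆ range n) (hV : V ⊆ range n)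
    (hcard : #E = #V) (h : ∀ i ∈ V, countBelow V i < countBelow E i) :
    pathWeight t q y n E V = t ^ #E * q ^ (∑ i ∈ V, i - ∑ i ∈ E, i - #E) *
      y ^ #{i ∈ range n | i ∉ E ∧ i ∉ V ∧ countBelow E i = countBelow V i} := by
  have hle : ∀ i, countBelow V i ≤ countBelow E i := by
    intro i
    induction i with
    | zero => simp [countBelow]
    | succ i ih =>
      rw [countBelow_succ, countBelow_succ]
      by_cases hi : i ∈ V
      · have := h i hi
        simp only [hi, if_true]
        omega
      · simp only [hi, if_false]
        omega
  have hcardV : ∑ i ∈ range n, (if i ∈ V then 1 else 0) = #V := by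
    rw [← sum_filter, filter_mem_eq_inter, inter_eq_right.mpr hV, sum_const, smul_eq_mul, mul_one]
  -- The truncated subtractions are exact, by `hle` and, at closing steps, by the strict inequality
  -- `h`.
  have hexp : ∑ i ∈ range n, (countBelow E i - countBelow V i - if i ∈ V then 1 else 0) =
      ∑ i ∈ V, i - ∑ i ∈ E, i - #E := by
    have h1 : ∑ i ∈ range n, (countBelow E i - countBelow V i - if i ∈ V then 1 else 0) +
        ∑ i ∈ range n, countBelow V i + #V = ∑ i ∈ range n, countBelow E i := by
      rw [← hcardV, ← sum_add_distrib, ← sum_add_distrib]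
      refine sum_congr rfl fun i _ => ?_
      have := hle i
      split_ifs with hi
      · have := h i hi
        omega
      · omega
    have h2 := sum_countBelow hE
    have h3 := sum_countBelow hV
    rw [← hcard] at h1 h3
    omega
  have ht : ∏ i ∈ range n, (if i ∈ E then t else 1) = t ^ #E := by
    rw [← prod_filter, filter_mem_eq_inter, inter_eq_right.mpr hE, prod_const]
  rw [← hexp, ← prod_pow_eq_pow_sum, ← ht, ← prod_const, prod_filter, ← prod_mul_distrib,
    ← prod_mul_distrib, pathWeight]
  refine prod_congr rfl fun i _ => ?_
  have h1 := hle i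
  by_cases hi : i ∈ V
  · simp [stepWeight, hi, h i hi]
  · by_cases he : i ∈ E
    · simp [stepWeight, hi, he, h1]
    · rcases h1.lt_or_eq with h2 | h2
      · simp [stepWeight, hi, he, h1, h2, h2.ne']
      · simp [stepWeight, hi, he, h2]

end Words

/-! ### 321-avoiding permutations and ballot pairs -/

section Permutations

variable {n : ℕ}

theorem avoidsPattern_pattern321_iff (π : Equiv.Perm (Fin n)) :
    AvoidsPattern π pattern321 ↔ ∀ i j k, i < j → j < k → π j < π i → ¬ π k < π j := by
  constructor
  · intro h i j k hij hjk h1 h2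
    refine h ⟨OrderEmbedding.ofStrictMono ![i, j, k] ?_, ?_⟩
    · rw [Fin.strictMono_iff_lt_succ]
      intro a
      fin_cases a <;> simp [hij, hjk]
    · intro a b
      fin_cases a <;> fin_cases b <;>
        simp [pattern321, h1, h2, h1.le, h2.le, h2.trans h1, (h2.trans h1).le]
  · rintro h ⟨f, hf⟩
    refine h (f 0) (f 1) (f 2) (by simp) (by simp) ?_ ?_
    · rw [hf]; decide
    · rw [hf]; decide

/-- The set of excedances of a permutation. -/
def excSet (π : Equiv.Perm (Fin n)) : Finset (Fin n) := {i | i < π i}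

theorem mem_excSet {π : Equiv.Perm (Fin n)} {i : Fin n} : i ∈ excSet π ↔ i < π i := by
  simp [excSet]

/-- Pigeonhole: the values below `π i` outnumber the positions before `i`. -/
theorem exists_lt_of_mem_excSet {π : Equiv.Perm (Fin n)} {i : Fin n} (hi : i < π i) :
    ∃ j, i < j ∧ π j < π i := by
  by_contra! h
  have hsub : (Iio (π i)).map π.symm.toEmbedding ⊆ Iio i := by
    intro j hj
    simp only [mem_map_equiv, Equiv.symm_symm, mem_Iio] at hj ⊢
    by_contra hc
    rcases (not_lt.mp hc).lt_or_eq with h1 | h1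
    · exact (h j h1).not_gt hj
    · exact lt_irrefl _ (h1 ▸ hj)
  have hc := card_le_card hsub
  rw [card_map, Fin.card_Iio, Fin.card_Iio] at hc
  exact hc.not_gt hi

theorem strictMonoOn_excSet {π : Equiv.Perm (Fin n)} (h : AvoidsPattern π pattern321) :
    StrictMonoOn π (excSet π) := by
  rw [avoidsPattern_pattern321_iff] at h
  intro i _ j hj hij
  rw [mem_coe, mem_excSet] at hj
  obtain ⟨k, hjk, hk⟩ := exists_lt_of_mem_excSet hj
  by_contra hc
  exact h i j k hij hjk (lt_of_le_of_ne (not_lt.mp hc) (π.injective.ne hij.ne')) hk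

theorem strictMonoOn_compl_excSet {π : Equiv.Perm (Fin n)} (h : AvoidsPattern π pattern321) :
    StrictMonoOn π ((excSet π)ᶜ : Finset (Fin n)) := by
  rw [avoidsPattern_pattern321_iff] at h
  intro i hi j _ hij
  rw [mem_coe, mem_compl, mem_excSet, not_lt] at hi
  by_contra hc
  have hji : π j < π i := lt_of_le_of_ne (not_lt.mp hc) (π.injective.ne hij.ne')
  -- A larger value before `i` would form a 321 with `i` and `j`. So `i + 1` positions take values
  -- below `π i`, forcing an excedance at `i`.
  have hsub : (insert j (Iio i)).map π.toEmbedding ⊆ Iio (π i) := by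
    intro v hv
    obtain ⟨k, hk, rfl⟩ := mem_map.mp hv
    rw [mem_insert, mem_Iio] at hk
    rw [mem_Iio]
    rcases hk with rfl | hk
    · exact hji
    · by_contra hc'
      exact h k i j hk hij (lt_of_le_of_ne (not_lt.mp hc') (π.injective.ne hk.ne')) hji
  have hcard := card_le_card hsub
  rw [card_map, card_insert_of_notMem (by simp [hij.le]), Fin.card_Iio, Fin.card_Iio] at hcard
  have := Fin.le_def.mp hi
  omega

/-- Two of the three positions of a 321 would lie in the same class. -/
theorem avoidsPattern_of_strictMonoOn {π : Equiv.Perm (Fin n)} {E : Finset (Fin n)}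
    (h1 : StrictMonoOn π E) (h2 : StrictMonoOn π (Eᶜ : Finset (Fin n))) :
    AvoidsPattern π pattern321 := by
  rw [avoidsPattern_pattern321_iff]
  intro i j k hij hjk hji hkj
  have key : ∀ {a b : Fin n}, a < b → π b < π a → ¬ (a ∈ E ↔ b ∈ E) := by
    intro a b hab hba hE
    by_cases ha : a ∈ E
    · exact (h1 (mem_coe.mpr ha) (mem_coe.mpr (hE.mp ha)) hab).not_gt hba
    · have hb : b ∉ E := fun hb => ha (hE.mpr hb)
      exact (h2 (by simpa using ha) (by simpa using hb) hab).not_gt hba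
  have a1 := key hij hji
  have a2 := key hjk hkj
  have a3 := key (hij.trans hjk) (hkj.trans hji)
  tauto

theorem countBelow_mono (A : Finset (Fin n)) {i j : Fin n} (h : i ≤ j) :
    countBelow A i ≤ countBelow A j :=
  card_le_card fun a ha => by
    rw [mem_filter] at ha ⊢
    exact ⟨ha.1, ha.2.trans_le h⟩

theorem countBelow_lt {A : Finset (Fin n)} {i j : Fin n} (hi : i ∈ A) (h : i < j) :
    countBelow A i < countBelow A j := by
  refine card_lt_card ⟨fun a ha => ?_, fun hs => ?_⟩
  · rw [mem_filter] at ha ⊢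
    exact ⟨ha.1, ha.2.trans h⟩
  · have := hs (mem_filter.mpr ⟨hi, h⟩)
    simp at this

theorem countBelow_injOn {A : Finset (Fin n)} {i j : Fin n} (hi : i ∈ A) (hj : j ∈ A)
    (h : countBelow A i = countBelow A j) : i = j := by
  rcases lt_trichotomy i j with hij | hij | hij
  · exact absurd h (countBelow_lt hi hij).ne
  · exact hij
  · exact absurd h (countBelow_lt hj hij).ne'

theorem countBelow_add_countBelow_compl (A : Finset (Fin n)) (i : Fin n) :
    countBelow A i + countBelow Aᶜ i = i := by
  have h1 : ({a ∈ A | a < i} : Finset (Fin n)) = {a ∈ Iio i | a ∈ A} := by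
    ext a; simp [and_comm]
  have h2 : ({a ∈ Aᶜ | a < i} : Finset (Fin n)) = {a ∈ Iio i | a ∉ A} := by
    ext a; simp [and_comm]
  rw [countBelow, countBelow, h1, h2, card_filter_add_card_filter_not, Fin.card_Iio]

theorem countBelow_map {π : Equiv.Perm (Fin n)} {E : Finset (Fin n)} (h : StrictMonoOn π E)
    {i : Fin n} (hi : i ∈ E) :
    countBelow (E.map π.toEmbedding) (π i) = countBelow E i := by
  rw [countBelow, filter_map, card_map, countBelow]
  congr 1
  ext a
  simp only [mem_filter, Function.comp_apply, Equiv.coe_toEmbedding, and_congr_right_iff]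
  exact fun ha => h.lt_iff_lt (mem_coe.mpr ha) (mem_coe.mpr hi)

theorem map_compl_perm (π : Equiv.Perm (Fin n)) (E : Finset (Fin n)) :
    Eᶜ.map π.toEmbedding = (E.map π.toEmbedding)ᶜ := by
  ext a
  simp [mem_map_equiv]

theorem eq_of_strictMonoOn {π σ : Equiv.Perm (Fin n)} {E : Finset (Fin n)}
    (hπ : StrictMonoOn π E) (hσ : StrictMonoOn σ E)
    (h : E.map π.toEmbedding = E.map σ.toEmbedding) {i : Fin n} (hi : i ∈ E) : π i = σ i := by
  have h1 := countBelow_map hπ hi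
  rw [h, ← countBelow_map hσ hi] at h1
  refine countBelow_injOn ?_ (mem_map_of_mem _ hi) h1
  rw [← h]
  exact mem_map_of_mem _ hi

theorem exists_perm_strictMonoOn {E V : Finset (Fin n)} (h : #E = #V) :
    ∃ π : Equiv.Perm (Fin n), StrictMonoOn π E ∧ StrictMonoOn π (Eᶜ : Finset (Fin n)) ∧
      E.map π.toEmbedding = V := by
  have h' : #Eᶜ = #Vᶜ := by rw [card_compl, card_compl, h]
  let σ : E ≃o V := (E.orderIsoOfFin rfl).symm.trans (V.orderIsoOfFin h.symm)
  let τ : (Eᶜ : Finset (Fin n)) ≃o (Vᶜ : Finset (Fin n)) :=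
    (Eᶜ.orderIsoOfFin rfl).symm.trans (Vᶜ.orderIsoOfFin h'.symm)
  let τ' : {x // ¬ x ∈ E} ≃ {x // ¬ x ∈ V} :=
    (Equiv.subtypeEquivRight fun x => by simp).trans
      (τ.toEquiv.trans (Equiv.subtypeEquivRight fun x => by simp))
  let π : Equiv.Perm (Fin n) := Equiv.subtypeCongr σ.toEquiv τ'
  have h1 : ∀ (i) (hi : i ∈ E), π i = σ ⟨i, hi⟩ := fun i hi => by
    simp [π, Equiv.subtypeCongr, Equiv.sumCompl_symm_apply_of_pos, hi]
  have h2 : ∀ (i) (hi : i ∈ Eᶜ), π i = τ ⟨i, hi⟩ := fun i hi => by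
    have hi' : i ∉ E := by simpa using hi
    simp [π, Equiv.subtypeCongr, Equiv.sumCompl_symm_apply_of_neg, hi', τ']
    rfl
  refine ⟨π, fun i hi j hj hij => ?_, fun i hi j hj hij => ?_, ?_⟩
  · rw [h1 i hi, h1 j hj]
    exact σ.strictMono hij
  · rw [h2 i hi, h2 j hj]
    exact τ.strictMono hij
  · refine eq_of_subset_of_card_le (fun v hv => ?_) (by rw [card_map, h])
    obtain ⟨i, hi, rfl⟩ := mem_map.mp hv
    rw [Equiv.coe_toEmbedding, h1 i hi]
    exact (σ ⟨i, hi⟩).2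

/-- The condition that arcs opened at `E` and closed at `V` form a path ending at height `0` and
never closing an arc that was not opened strictly earlier. -/
def IsBallotPair (E V : Finset (Fin n)) : Prop :=
  #E = #V ∧ ∀ j ∈ V, countBelow V j < countBelow E j

/-- The set of values taken at the excedances. -/
def excValues (π : Equiv.Perm (Fin n)) : Finset (Fin n) := (excSet π).map π.toEmbedding

theorem isBallotPair_excSet {π : Equiv.Perm (Fin n)} (h : AvoidsPattern π pattern321) :
    IsBallotPair (excSet π) (excValues π) := by
  refine ⟨(card_map _).symm, fun j hj => ?_⟩
  obtain ⟨i, hi, rfl⟩ := mem_map.mp hj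
  rw [Equiv.coe_toEmbedding, excValues, countBelow_map (strictMonoOn_excSet h) hi]
  exact countBelow_lt hi (mem_excSet.mp hi)

theorem exists_excSet_eq {E V : Finset (Fin n)} (h : IsBallotPair E V) :
    ∃ π : Equiv.Perm (Fin n), AvoidsPattern π pattern321 ∧ excSet π = E ∧ excValues π = V := by
  obtain ⟨π, h1, h2, h3⟩ := exists_perm_strictMonoOn h.1
  have hE : excSet π = E := by
    ext i
    rw [mem_excSet]
    refine ⟨fun hi => ?_, fun hi => ?_⟩
    · by_contra hiE
      have hiE' : i ∈ Eᶜ := by simpa using hiE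
      have e1 := countBelow_map h2 hiE'
      rw [map_compl_perm, h3] at e1
      have e2 := countBelow_add_countBelow_compl V (π i)
      have e3 := countBelow_add_countBelow_compl E (π i)
      have e4 := countBelow_lt hiE' hi
      -- The ballot condition is only given at points of `V`; it extends to `π i` through the last
      -- element `w` of `V` before it.
      have e5 : countBelow V (π i) ≤ countBelow E (π i) := by
        by_contra hc
        rw [not_le] at hc
        have hne : ({v ∈ V | v < π i} : Finset (Fin n)).Nonempty :=
          card_pos.mp ((Nat.zero_le _).trans_lt hc)
        set w := ({v ∈ V | v < π i} : Finset (Fin n)).max' hne with hw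
        have hwm := mem_filter.mp (max'_mem _ hne)
        rw [← hw] at hwm
        have a1 := h.2 w hwm.1
        have a2 := countBelow_mono E hwm.2.le
        have a3 : countBelow V (π i) ≤ countBelow V w + 1 := by
          rw [countBelow, countBelow, ← card_insert_of_notMem (a := w) (by simp)]
          refine card_le_card fun v hv => ?_
          rw [mem_insert, mem_filter]
          rcases (le_max' _ v hv).lt_or_eq with hlt | heq
          · exact Or.inr ⟨(mem_filter.mp hv).1, hlt⟩
          · exact Or.inl heq
        omega
      omega
    · have e1 := countBelow_map h1 hi
      rw [h3] at e1
      have e2 := h.2 (π i) (h3 ▸ mem_map_of_mem _ hi)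
      by_contra hc
      have := countBelow_mono E (not_lt.mp hc)
      omega
  exact ⟨π, avoidsPattern_of_strictMonoOn h1 h2, hE, by rw [excValues, hE, h3]⟩

theorem eq_of_excSet_eq {π σ : Equiv.Perm (Fin n)} (hπ : AvoidsPattern π pattern321)
    (hσ : AvoidsPattern σ pattern321) (hE : excSet π = excSet σ)
    (hV : excValues π = excValues σ) : π = σ := by
  ext i : 1
  have hV' : (excSet π).map π.toEmbedding = (excSet π).map σ.toEmbedding := by
    rw [excValues, excValues, ← hE] at hV
    exact hV
  have h1 := strictMonoOn_excSet hσ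
  have h2 := strictMonoOn_compl_excSet hσ
  rw [← hE] at h1 h2
  by_cases hi : i ∈ excSet π
  · exact eq_of_strictMonoOn (strictMonoOn_excSet hπ) h1 hV' hi
  · refine eq_of_strictMonoOn (strictMonoOn_compl_excSet hπ) h2 ?_ (mem_compl.mpr hi)
    rw [map_compl_perm, map_compl_perm, hV']

theorem excNum_eq_card (π : Equiv.Perm (Fin n)) : excNum π = #(excSet π) := rfl

/-- Inversions start only at excedances, and an excedance `i` starts exactly `π i - i` of them,
because every earlier position has a smaller value. -/
theorem invNum_add_sum_excSet {π : Equiv.Perm (Fin n)} (h : AvoidsPattern π pattern321) :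
    invNum π + ∑ i ∈ excSet π, (i : ℕ) = ∑ i ∈ excValues π, (i : ℕ) := by
  have h1 := strictMonoOn_excSet h
  have h2 := strictMonoOn_compl_excSet h
  have hinv : invNum π = ∑ i, #{j | i < j ∧ π j < π i} := by
    simp only [invNum, card_filter]
    rw [← univ_product_univ, sum_product]
  have hzero : ∀ i ∉ excSet π, #{j | i < j ∧ π j < π i} = 0 := by
    intro i hi
    rw [card_eq_zero, filter_eq_empty_iff]
    rintro j - ⟨hij, hji⟩
    by_cases hj : j ∈ excSet π
    · rw [mem_excSet] at hi hj
      exact absurd ((hij.trans hj).trans hji) hi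
    · exact (h2 (by simpa using hi) (by simpa using hj) hij).not_gt hji
  have hexc : ∀ i ∈ excSet π, #{j | i < j ∧ π j < π i} + (i : ℕ) = π i := by
    intro i hi
    have hunion : Iio (π i) =
        (({j | i < j ∧ π j < π i} : Finset (Fin n)) ∪ Iio i).map π.toEmbedding := by
      ext v
      obtain ⟨j, rfl⟩ := π.surjective v
      simp only [mem_map_equiv, Equiv.symm_apply_apply, mem_union, mem_filter, mem_univ, true_and,
        mem_Iio]
      refine ⟨fun hj => ?_, fun hj => ?_⟩
      · rcases lt_trichotomy i j with hij | rfl | hij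
        · exact Or.inl ⟨hij, hj⟩
        · exact absurd hj (lt_irrefl _)
        · exact Or.inr hij
      · rcases hj with hj | hj
        · exact hj.2
        · by_cases hjE : j ∈ excSet π
          · exact h1 hjE hi hj
          · rw [mem_excSet] at hjE hi
            exact ((not_lt.mp hjE).trans_lt hj).trans hi
    have hdisj : Disjoint ({j | i < j ∧ π j < π i} : Finset (Fin n)) (Iio i) := by
      rw [disjoint_left]
      intro j hj hj'
      exact (mem_filter.mp hj).2.1.not_gt (mem_Iio.mp hj')
    have := congrArg card hunion
    rw [card_map, card_union_of_disjoint hdisj, Fin.card_Iio, Fin.card_Iio] at this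
    exact this.symm
  rw [hinv, ← sum_subset (subset_univ (excSet π)) fun i _ hi => hzero i hi, ← sum_add_distrib,
    excValues, sum_map]
  exact sum_congr rfl hexc

/-- Off the excedances `π` preserves rank, from the complement of `E` to that of `V`; the rank of
`i` in a complement is `i` minus its `countBelow`. -/
theorem apply_eq_self_iff {π : Equiv.Perm (Fin n)} (h : AvoidsPattern π pattern321) (i : Fin n) :
    π i = i ↔ i ∉ excSet π ∧ i ∉ excValues π ∧
      countBelow (excSet π) i = countBelow (excValues π) i := by
  have h2 := strictMonoOn_compl_excSet h
  have a1 := countBelow_add_countBelow_compl (excSet π) i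
  have a2 := countBelow_add_countBelow_compl (excValues π) i
  have a3 : i ∉ excSet π → countBelow (excValues π)ᶜ (π i) = countBelow (excSet π)ᶜ i :=
    fun hi => by
      rw [← countBelow_map h2 (mem_compl.mpr hi), map_compl_perm, excValues]
  have a4 : ∀ j, π j ∈ excValues π ↔ j ∈ excSet π := fun j => by simp [excValues]
  refine ⟨fun hi => ?_, fun ⟨hE, hV, hc⟩ => ?_⟩
  · have hE : i ∉ excSet π := by rw [mem_excSet, hi]; exact lt_irrefl _
    have hV : i ∉ excValues π := by rw [← a4, hi] at hE; exact hE
    refine ⟨hE, hV, ?_⟩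
    have := a3 hE
    rw [hi] at this
    omega
  · refine countBelow_injOn (mem_compl.mpr (mt (a4 i).mp hE)) (mem_compl.mpr hV) ?_
    rw [a3 hE]
    omega

end Permutations

/-! ### Generating functions of 321-avoiding permutations and derangements -/

section Enumeration

variable {R : Type*} [CommRing R]

theorem sum_powerset_range {M : Type*} [AddCommMonoid M] (n : ℕ) (f : Finset ℕ → M) :
    ∑ A ∈ (range n).powerset, f A = ∑ A : Finset (Fin n), f (A.map Fin.valEmbedding) := by
  symm
  refine sum_nbij (fun A => A.map Fin.valEmbedding) ?_ (map_injective _).injOn ?_ fun _ _ => rfl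
  · intro A _
    rw [mem_powerset]
    intro a ha
    obtain ⟨i, _, rfl⟩ := mem_map.mp ha
    exact mem_range.mpr i.isLt
  · intro A hA
    rw [mem_coe, mem_powerset, ← Nat.Iio_eq_range, ← Fin.map_valEmbedding_univ, subset_map_iff] at hA
    obtain ⟨u, _, rfl⟩ := hA
    exact ⟨u, by simp, rfl⟩

theorem countBelow_map_val {n : ℕ} (A : Finset (Fin n)) (i : Fin n) :
    countBelow (A.map Fin.valEmbedding) (i : ℕ) = countBelow A i := by
  rw [countBelow, filter_map, card_map, countBelow]
  rfl

theorem map_val_subset_range {n : ℕ} (A : Finset (Fin n)) :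
    A.map Fin.valEmbedding ⊆ range n := by
  intro a ha
  obtain ⟨i, _, rfl⟩ := mem_map.mp ha
  exact mem_range.mpr i.isLt

theorem pathWeight_excSet (t q y : R) {n : ℕ} {π : Equiv.Perm (Fin n)}
    (h : AvoidsPattern π pattern321) :
    pathWeight t q y n ((excSet π).map Fin.valEmbedding) ((excValues π).map Fin.valEmbedding) =
      t ^ excNum π * q ^ (invNum π - excNum π) * y ^ #{i | π i = i} := by
  obtain ⟨hcard, hlt⟩ := isBallotPair_excSet h
  rw [pathWeight_eq (map_val_subset_range _) (map_val_subset_range _) (by simpa using hcard)]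
  · have hfix : ({i ∈ range n | i ∉ (excSet π).map Fin.valEmbedding ∧
        i ∉ (excValues π).map Fin.valEmbedding ∧
        countBelow ((excSet π).map Fin.valEmbedding) i =
          countBelow ((excValues π).map Fin.valEmbedding) i} : Finset ℕ) =
        ({i | π i = i} : Finset (Fin n)).map Fin.valEmbedding := by
      ext a
      rw [mem_filter, mem_range]
      constructor
      · rintro ⟨ha, h1, h2, h3⟩
        refine mem_map.mpr ⟨⟨a, ha⟩, ?_, rfl⟩
        rw [mem_filter, apply_eq_self_iff h, ← countBelow_map_val, ← countBelow_map_val]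
        exact ⟨mem_univ _, fun hE => h1 (mem_map_of_mem _ hE), fun hV => h2 (mem_map_of_mem _ hV),
          h3⟩
      · intro hm
        obtain ⟨i, hi, rfl⟩ := mem_map.mp hm
        rw [mem_filter, apply_eq_self_iff h, ← countBelow_map_val, ← countBelow_map_val] at hi
        refine ⟨i.isLt, ?_, ?_, hi.2.2.2⟩
        · rw [mem_map' Fin.valEmbedding]
          exact hi.2.1
        · rw [mem_map' Fin.valEmbedding]
          exact hi.2.2.1
    rw [hfix, card_map, card_map, sum_map, sum_map, excNum_eq_card]
    simp only [Fin.valEmbedding_apply]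
    rw [← invNum_add_sum_excSet h, Nat.add_sub_cancel]
  · intro j hj
    obtain ⟨i, hi, rfl⟩ := mem_map.mp hj
    rw [Fin.valEmbedding_apply, countBelow_map_val, countBelow_map_val]
    exact hlt i hi

theorem mem_perms321 {n : ℕ} {π : Equiv.Perm (Fin n)} :
    π ∈ perms321 n ↔ AvoidsPattern π pattern321 := by
  simp [perms321]

/-- The joint distribution of excedances, inversions and fixed points over `321`-avoiding
permutations is a weighted count of Motzkin paths. -/
theorem sum_perms321 (t q y : R) (n : ℕ) :
    ∑ π ∈ perms321 n, t ^ excNum π * q ^ (invNum π - excNum π) * y ^ #{i | π i = i} =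
      motzkinSum t q y n 0 := by
  rw [← sum_pathWeight, sum_powerset_range]
  simp only [sum_powerset_range, card_map]
  rw [← sum_product', univ_product_univ]
  -- Pairs outside the image are not ballot pairs, and their terms vanish.
  refine sum_of_injOn (fun π => (excSet π, excValues π)) ?_ ?_ ?_ ?_
  · intro π hπ σ hσ hπσ
    rw [mem_coe, mem_perms321] at hπ hσ
    exact eq_of_excSet_eq hπ hσ (congrArg Prod.fst hπσ) (congrArg Prod.snd hπσ)
  · exact fun _ _ => mem_coe.mpr (mem_univ _)
  · rintro ⟨E, V⟩ - hEV
    rw [ite_eq_right_iff]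
    intro hcard
    by_cases hb : ∀ j ∈ V, countBelow V j < countBelow E j
    · obtain ⟨π, hπ, h1, h2⟩ := exists_excSet_eq ⟨hcard, hb⟩
      exact absurd ⟨π, mem_coe.mpr (mem_perms321.mpr hπ), Prod.ext h1 h2⟩ hEV
    · push Not at hb
      obtain ⟨j, hj, hle⟩ := hb
      refine pathWeight_eq_zero j.isLt (mem_map_of_mem Fin.valEmbedding hj) ?_
      rw [countBelow_map_val, countBelow_map_val]
      exact hle
  · intro π hπ
    rw [mem_perms321] at hπ
    rw [if_pos (isBallotPair_excSet hπ).1, pathWeight_excSet t q y hπ]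

theorem sum_perms321_eq_qtCatalan (t q : R) (n : ℕ) :
    ∑ π ∈ perms321 n, t ^ excNum π * q ^ (invNum π - excNum π) = qtCatalan n t q := by
  rw [qtCatalan_eq_motzkinSum, ← sum_perms321]
  simp

theorem sum_derangements321 (q : R) (n : ℕ) :
    ∑ π ∈ derangements321 n, (-1) ^ excNum π * q ^ invNum π = coeff n (signedCarlitzSeries q) := by
  rw [← motzkinSum_neg_zero, ← sum_perms321, derangements321, sum_filter]
  refine sum_congr rfl fun π _ => ?_
  have hpow : (-q) ^ excNum π * q ^ (invNum π - excNum π) = (-1) ^ excNum π * q ^ invNum π := by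
    rw [neg_pow, mul_assoc, ← pow_add, Nat.add_sub_cancel' (excNum_le_invNum π)]
  have hfix : π ∈ derangements (Fin n) ↔ #{i | π i = i} = 0 := by
    rw [card_eq_zero, filter_eq_empty_iff]
    simp [derangements]
  rw [hpow]
  split_ifs with h
  · rw [hfix.mp h, pow_zero, mul_one]
  -- With `y = 0`, the factor `0 ^ fix` selects the derangements.
  · rw [zero_pow (mt hfix.mpr h), mul_zero]

end Enumeration

theorem theorem1p4 {R : Type*} [CommRing R] (q : R) (n : ℕ) (hn : 1 ≤ n) :
    (qtCatalan n (-1) q =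
        ∑ π ∈ perms321 n, (-1) ^ excNum π * q ^ (invNum π - excNum π)) ∧
      (∑ π ∈ perms321 n, (-1) ^ excNum π * q ^ (invNum π - excNum π) =
        if Even n then 0 else (-q) ^ ((n - 1) / 2) * carlitzCatalan ((n - 1) / 2) (q ^ 2)) ∧
      (∑ π ∈ derangements321 n, (-1) ^ excNum π * q ^ invNum π =
        if Even n then (-q) ^ (n / 2) * carlitzCatalan (n / 2) (q ^ 2) else 0) := by
  have hodd : qtCatalan n (-1) q =
      if Even n then 0 else (-q) ^ ((n - 1) / 2) * carlitzCatalan ((n - 1) / 2) (q ^ 2) := by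
    obtain ⟨m, rfl⟩ := Nat.exists_eq_add_of_le' hn
    rw [qtCatalan_succ_neg_one, coeff_signedCarlitzSeries, Nat.add_sub_cancel]
    simp only [Nat.even_add_one, ite_not]
  rw [sum_perms321_eq_qtCatalan, sum_derangements321, coeff_signedCarlitzSeries]
  exact ⟨rfl, hodd, rfl⟩
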